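/- **Setting.** A dual quaternion is $\hat q=q_s+q_d\epsilon$ with real quaternions $q_s,q_d$ and $\epsilon^2=0$; its conjugate is $\hat q^*=q_s^*+q_d^*\epsilon$. The set $\hat{\mathbb U}$ of unit dual quaternions consists of those with $|q_s|=1$ and $q_s^*q_d+q_d^*q_s=0$. The 2-norm of a vector $\hat{\mathbf x}=\mathbf x_s+\mathbf x_d\epsilon\in\hat{\mathbb Q}^n$ is the dual number $\|\hat{\mathbf x}\|=\|\mathbf x_d\|\epsilon$ if $\mathbf x_s=0$, and $\|\hat{\mathbf x}\|=\|\mathbf x_s\|+\frac{\mathbf x_s^*\mathbf x_d+\mathbf x_d^*\mathbf x_s}{\|\mathbf x_s\|}\epsilon$ otherwise. Dual numbers are ordered by $a_s+a_d\epsilon\le b_s+b_d\epsilon$ iff $a_s<b_s$, or $a_s=b_s$ and $a_d\le b_d$. Let $G=(V,E)$ be a finite directed graph with $n$ vertices, where $(i,j)\in E$ means that $i$ senses $j$, so that information flows from $j$ to $i$. Let $L=D-A$ be its Laplacian, where $D$ is the diagonal matrix of the out-degrees $d_i=|\{j:(i,j)\in E\}|$ and $a_{ij}=1$ if $(i,j)\in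 E$, $a_{ij}=0$ otherwise. Let the arcs carry weights $\hat q_{d_{ij}}\in\hat{\mathbb U}$, and let $\hat L=D-\hat A$ with $\hat a_{ij}=\hat q_{d_{ij}}$ if $(i,j)\in E$, $\hat a_{ij}=0$ otherwise. **Theorem.** Assume that $G$ contains a directed spanning tree in the direction of the information flow (there is a root $r$ and a spanning subgraph in which $r$ senses nobody, every other vertex senses exactly one vertex, and every vertex is joined to $r$ by a path of arcs leading from the vertex to $r$), and that the weights are reasonable: $\hat q_{d_{ij}}=\hat q_{d_i}^*\hat q_{d_j}$ for all $(i,j)\in E$, for some $\hat{\mathbf q}_d\in\hat{\mathbb U}^n$. Let $K$ be a real diagonal matrix with positive diagonal entries, $\hat Q=\mathrm{diag}(\hat{\mathbf q}_d)$ and $\hat K=\hat Q^*K\hat Q$. (i) Every solution $\hat{\mathbf z}:[0,\infty)\to\hat{\mathbb Q}^n$ of $\dot{\hat{\mathbf z}}=-\hat K\hat L\hat{\mathbf z}$, whatever its initial value, converges as $t\to\infty$ to $\hat{\mathbf z}^\infty=\bar{\hat{\mathbf q}}_d\,\hat c=(\hat q_{d_i}^*\hat c)_i$ for some $\hat c\in\hat{\mathbb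 Q}$. (ii) Let $n\ge2$. Order the complex eigenvalues of $KL$, counted with algebraic multiplicity, by their real parts, let $\lambda_{2r}$ be the real part of the second one, let $n_0$ be the size of the largest Jordan block of $KL$ that belongs to a nonzero eigenvalue, and put $c_{n_0}(t)=n_0-1+\frac{n_0}{(n_0-1)!}t^{n_0-1}$. Then $\lambda_{2r}>0$, and if $\hat{\mathbf z}(0)\in\hat{\mathbb U}^n$, then $\|\hat{\mathbf z}(t)-\hat{\mathbf z}^\infty\|$ tends to zero R-linearly with rate $\exp(-\lambda_{2r})$, up to the polynomial factor $c_{n_0}(t)$. That is, there is a constant $C>0$ that depends only on $G$ and $K$ such that, for all such solutions and all $t\ge0$, $$\|\hat{\mathbf z}(t)-\hat{\mathbf z}^\infty\|\le C\,c_{n_0}(t)\,e^{-\lambda_{2r}t}$$ in the order of dual numbers; and for each such solution there is a constant $C'$ such that the absolute values of the standard part and of the dual part of $\|\hat{\mathbf z}(t)-\hat{\mathbf z}^\infty\|$ are both at most $C'c_{n_0}(t)e^{-\lambda_{2r}t}$ for all $t\ge0$. -/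

import Mathlib

open Filter Topology Matrix Quaternion

noncomputable section

namespace DQFormation

/-! ### Dual quaternions -/

/-- Dual quaternions `q = q_s + q_d ε` with `ε ^ 2 = 0`; the standard part `q_s` is `q.fst`, the
dual part `q_d` is `q.snd`. -/
abbrev DualQuaternion : Type := DualNumber ℍ[ℝ]

/-- Conjugation of dual quaternions: `(q_s + q_d ε)* = q_s* + q_d* ε`. -/
instance : Star DualQuaternion where
  star q := TrivSqZeroExt.inl (star q.fst) + TrivSqZeroExt.inr (star q.snd)

@[simp]
theorem fst_star (q : DualQuaternion) : (star q).fst = star q.fst := by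
  change star q.fst + 0 = _
  rw [add_zero]

@[simp]
theorem snd_star (q : DualQuaternion) : (star q).snd = star q.snd := by
  change 0 + star q.snd = _
  rw [zero_add]

instance : StarRing DualQuaternion where
  star_involutive q := by ext1 <;> simp
  star_mul p q := by
    ext1
    · simp
    · simp [add_comm]
  star_add p q := by ext1 <;> simp

/-- The set of unit dual quaternions: `|q_s| = 1` and `q_s* q_d + q_d* q_s = 0`. -/
def unitDualQuaternions : Set DualQuaternion :=
  {q | ‖q.fst‖ = 1 ∧ star q.fst * q.snd + star q.snd * q.fst = 0}

/-- The Euclidean norm of a quaternion vector. -/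
def quatVecNorm {V : Type*} [Fintype V] (x : V → ℍ[ℝ]) : ℝ :=
  √(∑ i, ‖x i‖ ^ 2)

open Classical in
/-- The 2-norm of a dual quaternion vector, a dual number: `‖x_d‖ ε` if `x_s = 0`, and
`‖x_s‖ + ((x_s* x_d + x_d* x_s) / ‖x_s‖) ε` otherwise. The quaternion `x_s* x_d + x_d* x_s` is its
own conjugate, so it is identified with its real part. -/
def dualVecNorm {V : Type*} [Fintype V] (x : V → DualQuaternion) : DualNumber ℝ :=
  if (∀ i, (x i).fst = 0) then
    TrivSqZeroExt.inr (quatVecNorm fun i => (x i).snd)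
  else
    TrivSqZeroExt.inl (quatVecNorm fun i => (x i).fst) +
      TrivSqZeroExt.inr
        ((∑ i, (star (x i).fst * (x i).snd + star (x i).snd * (x i).fst)).re /
          quatVecNorm fun i => (x i).fst)

/-- The total order of dual numbers: `a ≤ b` if `a_s < b_s`, or `a_s = b_s` and `a_d ≤ b_d`. -/
def DualLE (a b : DualNumber ℝ) : Prop :=
  a.fst < b.fst ∨ (a.fst = b.fst ∧ a.snd ≤ b.snd)

/-! ### Directed graphs and Laplacians

An arc `(i, j)`, that is `G.Adj i j`, means that body `i` senses body `j`. -/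

section Graph

variable {V : Type*}

/-- The sensing digraph `G` contains a directed spanning tree, in the direction in which information
flows (an arc `(i, j)`, by which `i` senses `j`, carries information from `j` to `i`): a spanning
subgraph `T` with a root `r` which senses nobody in `T`, in which every other body senses
exactly one body (its parent), and in which information flows from `r` to every body, that is, a
chain of arcs of `T` leads from every body to `r`. -/
def HasDirectedSpanningTree (G : Digraph V) : Prop :=
  ∃ (T : Digraph V) (r : V), T ≤ G ∧ (∀ j, ¬ T.Adj r j) ∧ (∀ i, i ≠ r → ∃! j, T.Adj i j) ∧
    ∀ i, Relation.ReflTransGen T.Adj i r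

variable [Fintype V]

/-- `d_i`, the number of arcs going out from `i`. -/
def outDegree (G : Digraph V) [DecidableRel G.Adj] (i : V) : ℕ :=
  (Finset.univ.filter fun j => G.Adj i j).card

/-- The Laplacian `D - A` of a directed graph. -/
def laplacian [DecidableEq V] (G : Digraph V) [DecidableRel G.Adj] : Matrix V V ℝ :=
  Matrix.diagonal (fun i => (outDegree G i : ℝ)) - Matrix.of fun i j => if G.Adj i j then 1 else 0

end Graph

/-- The weights `φ(i, j) = q_{d_ij}` that make a digraph `G` a unit dual quaternion directed graph;
only the values on arcs of `G` matter. -/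
structure UDQWeights {V : Type*} (G : Digraph V) where
  /-- The weight of the arc `(i, j)`. -/
  wt : V → V → DualQuaternion
  wt_mem : ∀ i j, G.Adj i j → wt i j ∈ unitDualQuaternions

namespace UDQWeights

variable {V : Type*} {G : Digraph V}

/-- `q ∈ Û^n` is a desired formation for the weights: `q_{d_ij} = q_i* q_j` on every arc. The
weights are reasonable if there is such a `q`. -/
def IsDesiredFormation (φ : UDQWeights G) (q : V → DualQuaternion) : Prop :=
  (∀ i, q i ∈ unitDualQuaternions) ∧ ∀ i j, G.Adj i j → φ.wt i j = star (q i) * q j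

/-- The dual quaternion Laplacian `D - Â`. -/
def dualLaplacian [Fintype V] [DecidableEq V] [DecidableRel G.Adj] (φ : UDQWeights G) :
    Matrix V V DualQuaternion :=
  Matrix.diagonal (fun i => (outDegree G i : DualQuaternion)) -
    Matrix.of fun i j => if G.Adj i j then φ.wt i j else 0

end UDQWeights

/-! ### The control law -/

/-- The matrix `Q* K Q` with `Q = diag(q)` and `K = diag(k)` a real diagonal matrix. -/
def precondition {V : Type*} [Fintype V] [DecidableEq V] (k : V → ℝ) (q : V → DualQuaternion) :
    Matrix V V DualQuaternion :=
  (Matrix.diagonal q)ᴴ * (Matrix.diagonal k).map (algebraMap ℝ DualQuaternion) * Matrix.diagonal q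

/-- `z` solves `ż = - K̂ L̂ z` for times `t ≥ 0` (with a one-sided derivative at `t = 0`). -/
def IsControlledMotion {V : Type*} [Fintype V] (Khat Lhat : Matrix V V DualQuaternion)
    (z : ℝ → V → DualQuaternion) : Prop :=
  ∀ t, 0 ≤ t → HasDerivWithinAt z (-((Khat * Lhat) *ᵥ z t)) (Set.Ici 0) t

/-! ### Spectral data of a real matrix -/

section Spectral

variable {V : Type*} [Fintype V] [DecidableEq V]

/-- The complex eigenvalues of a real matrix, with algebraic multiplicity. -/
def complexEigenvalues (A : Matrix V V ℝ) : Multiset ℂ :=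
  (A.map (algebraMap ℝ ℂ)).charpoly.roots

/-- The second entry in the increasing list of the real parts of the complex eigenvalues, counted
with algebraic multiplicity. (The default value `0` is used only if there are fewer than two
eigenvalues.) -/
def secondSmallestRe (A : Matrix V V ℝ) : ℝ :=
  (((complexEigenvalues A).map Complex.re).sort (· ≤ ·)).getD 1 0

/-- The size of the largest Jordan block for a nonzero eigenvalue of `A`. For an eigenvalue `μ` the
largest block has size the least `m` with `ker (A - μ)^m = ker (A - μ)^(m + 1) = ⋯`. -/
def largestNonzeroJordanBlock (A : Matrix V V ℝ) : ℕ :=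
  ((complexEigenvalues A).toFinset.erase 0).sup fun μ =>
    Module.End.maxGenEigenspaceIndex (Matrix.toLin' (A.map (algebraMap ℝ ℂ))) μ

end Spectral

/-- The polynomial prefactor `m - 1 + m t^(m-1) / (m-1)!` for a Jordan block of size `m ≥ 1`. -/
def jordanFactor (m : ℕ) (t : ℝ) : ℝ :=
  (m : ℝ) - 1 + (m : ℝ) / ((m - 1).factorial : ℝ) * t ^ (m - 1)

end DQFormation

end

open DQFormation

namespace DQFormation

/-! Put `w i = q i * z i`. Since `q i * star (q i) = 1` and the weights are reasonable, the control
law becomes `w' = -K L w` with a real matrix (`mul_precondition_mul_dualLaplacian`), so the standard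
and dual parts of `w` solve the same real linear system independently.

The spectrum of `K L` follows from maximum principles. Reachability of the root makes the kernel the
constants. Comparing a maximum with a minimum excludes Jordan chains at `0`, so `0` is a simple
eigenvalue, and at an entry of largest modulus every other eigenvalue is seen to have positive real
part.

Since generalized eigenspaces span, explicit exponential-polynomial solutions give every column of
the fundamental matrix a constant limit `p j`. Uniqueness yields `w(t) → ∑ p j • w j (0)` with an
error `C ψ(t) ∑ ‖w j (0)‖`, for any `ψ` dominating the nonzero modes (`exists_consensus_weights`).

For (i), `ψ` is the sum of all modes; for (ii), it is `c_{n₀}(t) exp(-λ_{2r} t)`. Unit initial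
values make the standard parts of all `w j (0)` have norm one, so the first constant depends on `G`
and `K` only; the dual parts affect only `C'`. -/

theorem HasDirectedSpanningTree.exists_root {V : Type*} {G : Digraph V}
    (hG : HasDirectedSpanningTree G) : ∃ r, ∀ i, Relation.ReflTransGen G.Adj i r := by
  obtain ⟨T, r, hT, -, -, h⟩ := hG
  exact ⟨r, fun i => Relation.ReflTransGen.mono (fun _ _ hab => hT hab) _ _ (h i)⟩

/-! ### Spectrum of `K L` -/

section Spectral

variable {V : Type*} [Fintype V] {G : Digraph V} [DecidableRel G.Adj]

/-- The maximum principle. -/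
theorem le_root_of_sum_sub_eq_zero {r : V} (hr : ∀ i, Relation.ReflTransGen G.Adj i r)
    {v : V → ℝ} (hv : ∀ i, ∑ j ∈ Finset.univ.filter (fun j => G.Adj i j), (v i - v j) = 0) (i : V) :
    v i ≤ v r := by
  have : Nonempty V := ⟨r⟩
  obtain ⟨m, hm⟩ := Finite.exists_max v
  -- The set of maximum points is closed under arcs: there the summands are nonnegative with sum
  -- zero. A path from `m` thus carries the maximum to the root.
  have key : ∀ j, Relation.ReflTransGen G.Adj m j → v j = v m := by
    intro j hj
    induction hj with
    | refl => rfl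
    | @tail a b _ hab ih =>
      have h := (Finset.sum_eq_zero_iff_of_nonneg (fun j _ => by
        rw [ih]; exact sub_nonneg.2 (hm j))).1 (hv a) b (by simpa using hab)
      linarith
  rw [key r (hr m)]
  exact hm i

theorem eq_root_of_sum_sub_eq_zero {r : V} (hr : ∀ i, Relation.ReflTransGen G.Adj i r)
    {v : V → ℝ} (hv : ∀ i, ∑ j ∈ Finset.univ.filter (fun j => G.Adj i j), (v i - v j) = 0) (i : V) :
    v i = v r := by
  refine le_antisymm (le_root_of_sum_sub_eq_zero hr hv i) ?_
  have h := le_root_of_sum_sub_eq_zero hr (v := fun i => - v i) (fun i => by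
    rw [← neg_eq_zero, ← Finset.sum_neg_distrib, ← hv i]
    exact Finset.sum_congr rfl fun j _ => by ring) i
  linarith

/-- The left side is nonnegative at a maximum of `v` and nonpositive at a minimum. So `K L` takes no
nonzero constant value, which excludes Jordan chains at `0`. -/
theorem eq_zero_of_smul_sum_sub_eq_const [Nonempty V] {k : V → ℝ} (hk : ∀ i, 0 < k i)
    {v : V → ℝ} {c : ℝ}
    (hv : ∀ i, k i * ∑ j ∈ Finset.univ.filter (fun j => G.Adj i j), (v i - v j) = c) : c = 0 := by
  obtain ⟨m, hm⟩ := Finite.exists_max v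
  obtain ⟨l, hl⟩ := Finite.exists_min v
  refine le_antisymm ?_ ?_
  · rw [← hv l]
    exact mul_nonpos_of_nonneg_of_nonpos (hk l).le
      (Finset.sum_nonpos fun j _ => sub_nonpos.2 (hl j))
  · rw [← hv m]
    exact mul_nonneg (hk m).le (Finset.sum_nonneg fun j _ => sub_nonneg.2 (hm j))

variable [DecidableEq V]

theorem sum_diagonal_mul_laplacian_smul {E : Type*} [AddCommGroup E] [Module ℝ E]
    (k : V → ℝ) (v : V → E) (i : V) :
    ∑ j, (diagonal k * laplacian G) i j • v j =
      k i • ∑ j ∈ Finset.univ.filter (fun j => G.Adj i j), (v i - v j) := by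
  simp only [Matrix.diagonal_mul, mul_smul, ← Finset.smul_sum]
  congr 1
  simp only [laplacian, Matrix.sub_apply, Matrix.of_apply, sub_smul, Finset.sum_sub_distrib,
    Matrix.diagonal_apply, ite_smul, zero_smul, one_smul, Finset.sum_ite_eq, Finset.mem_univ,
    if_true, Finset.sum_const, outDegree, Nat.cast_smul_eq_nsmul, Finset.sum_filter]

/-- The complex endomorphism of a real square matrix. -/
noncomputable abbrev complexEnd (A : Matrix V V ℝ) : Module.End ℂ (V → ℂ) :=
  Matrix.toLin' (A.map (algebraMap ℝ ℂ))

theorem complexEnd_apply (A : Matrix V V ℝ) (v : V → ℂ) (i : V) :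
    complexEnd A v i = ∑ j, A i j • v j := by
  simp [complexEnd, Matrix.toLin'_apply, Matrix.mulVec, dotProduct]

theorem complexEnd_klap_apply (k : V → ℝ) (v : V → ℂ) (i : V) :
    complexEnd (diagonal k * laplacian G) v i =
      k i • ∑ j ∈ Finset.univ.filter (fun j => G.Adj i j), (v i - v j) := by
  rw [complexEnd_apply, sum_diagonal_mul_laplacian_smul]

theorem complexEnd_klap_const (k : V → ℝ) (c : ℂ) :
    complexEnd (diagonal k * laplacian G) (fun _ => c) = 0 := by
  ext i
  simp [complexEnd_klap_apply]

theorem eq_const_of_complexEnd_klap_eq_zero {r : V}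
    (hr : ∀ i, Relation.ReflTransGen G.Adj i r) {k : V → ℝ} (hk : ∀ i, 0 < k i) {v : V → ℂ}
    (hv : complexEnd (diagonal k * laplacian G) v = 0) (i : V) : v i = v r := by
  have h : ∀ i, ∑ j ∈ Finset.univ.filter (fun j => G.Adj i j), (v i - v j) = 0 := fun i => by
    have := congrFun hv i
    rw [complexEnd_klap_apply] at this
    exact (smul_eq_zero.1 this).resolve_left (hk i).ne'
  apply Complex.ext
  · exact eq_root_of_sum_sub_eq_zero hr (v := fun i => (v i).re)
      (fun i => by simpa using congrArg Complex.re (h i)) i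
  · exact eq_root_of_sum_sub_eq_zero hr (v := fun i => (v i).im)
      (fun i => by simpa using congrArg Complex.im (h i)) i

theorem complexEnd_klap_eq_zero_of_apply {r : V}
    (hr : ∀ i, Relation.ReflTransGen G.Adj i r) {k : V → ℝ} (hk : ∀ i, 0 < k i) {v : V → ℂ}
    (hv : complexEnd (diagonal k * laplacian G) (complexEnd (diagonal k * laplacian G) v) = 0) :
    complexEnd (diagonal k * laplacian G) v = 0 := by
  have : Nonempty V := ⟨r⟩
  have h := eq_const_of_complexEnd_klap_eq_zero hr hk hv
  have h0 : complexEnd (diagonal k * laplacian G) v r = 0 := by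
    apply Complex.ext
    · refine eq_zero_of_smul_sum_sub_eq_const (G := G) hk (v := fun i => (v i).re) fun i => ?_
      rw [← h i, complexEnd_klap_apply]
      simp
    · refine eq_zero_of_smul_sum_sub_eq_const (G := G) hk (v := fun i => (v i).im) fun i => ?_
      rw [← h i, complexEnd_klap_apply]
      simp
  ext i
  rw [h i, h0, Pi.zero_apply]

theorem complexEnd_klap_eq_zero_of_pow {r : V}
    (hr : ∀ i, Relation.ReflTransGen G.Adj i r) {k : V → ℝ} (hk : ∀ i, 0 < k i) {v : V → ℂ} (n : ℕ)
    (hv : (complexEnd (diagonal k * laplacian G) ^ n) v = 0) :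
    complexEnd (diagonal k * laplacian G) v = 0 := by
  induction n with
  | zero =>
    have : v = 0 := by simpa using hv
    rw [this, map_zero]
  | succ n ih =>
    cases n with
    | zero => simpa using hv
    | succ n =>
      apply ih
      rw [pow_succ', pow_succ'] at hv
      rw [pow_succ']
      exact complexEnd_klap_eq_zero_of_apply hr hk hv

theorem maxGenEigenspace_klap_zero {r : V}
    (hr : ∀ i, Relation.ReflTransGen G.Adj i r) {k : V → ℝ} (hk : ∀ i, 0 < k i) :
    (complexEnd (diagonal k * laplacian G)).maxGenEigenspace 0 =
      Submodule.span ℂ {fun _ => (1 : ℂ)} := by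
  ext v
  rw [Module.End.mem_maxGenEigenspace, Submodule.mem_span_singleton]
  constructor
  · rintro ⟨n, hn⟩
    rw [zero_smul, sub_zero] at hn
    refine ⟨v r, ?_⟩
    ext i
    rw [eq_const_of_complexEnd_klap_eq_zero hr hk (complexEnd_klap_eq_zero_of_pow hr hk n hn) i]
    simp
  · rintro ⟨a, rfl⟩
    refine ⟨1, ?_⟩
    rw [zero_smul, sub_zero, pow_one, map_smul, complexEnd_klap_const, smul_zero]

/-- Pair the eigenvalue equation with the conjugate of an entry `v m` of largest modulus. Each
neighbour contributes a nonnegative real part; if all vanish, the neighbours equal `v m`, and then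
`μ * v m = 0`. -/
theorem re_pos_of_complexEnd_klap {k : V → ℝ} (hk : ∀ i, 0 < k i) {μ : ℂ} (hμ : μ ≠ 0)
    {v : V → ℂ} (hv0 : v ≠ 0) (hv : complexEnd (diagonal k * laplacian G) v = μ • v) :
    0 < μ.re := by
  obtain ⟨i₀, hi₀⟩ := Function.ne_iff.1 hv0
  have : Nonempty V := ⟨i₀⟩
  obtain ⟨m, hm⟩ := Finite.exists_max fun i => Complex.normSq (v i)
  have hmpos : 0 < Complex.normSq (v m) :=
    (Complex.normSq_pos.2 hi₀).trans_le (hm i₀)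
  have heq := congrFun hv m
  rw [complexEnd_klap_apply, Pi.smul_apply] at heq
  have hnn : ∀ j, 0 ≤ (star (v m) * (v m - v j)).re := fun j => by
    have h1 := hm j
    simp only [Complex.normSq_apply] at h1
    simp
    nlinarith [sq_nonneg ((v m).re - (v j).re), sq_nonneg ((v m).im - (v j).im)]
  have hre : μ.re * Complex.normSq (v m) =
      k m * ∑ j ∈ Finset.univ.filter (fun j => G.Adj m j), (star (v m) * (v m - v j)).re := by
    have := congrArg (fun x => (star (v m) * x).re) heq
    rw [← Complex.re_sum, ← Finset.mul_sum, ← smul_eq_mul (k m), ← Complex.smul_re,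
      ← mul_smul_comm, this]
    simp [Complex.normSq_apply]
    ring
  have hge : 0 ≤ μ.re * Complex.normSq (v m) := by
    rw [hre]
    exact mul_nonneg (hk m).le (Finset.sum_nonneg fun j _ => hnn j)
  rcases (nonneg_of_mul_nonneg_left hge hmpos).lt_or_eq with h | h
  · exact h
  exfalso
  rw [← h, zero_mul, eq_comm, mul_eq_zero, or_iff_right (hk m).ne',
    Finset.sum_eq_zero_iff_of_nonneg fun j _ => hnn j] at hre
  have hsum : ∑ j ∈ Finset.univ.filter (fun j => G.Adj m j), (v m - v j) = 0 := by
    refine Finset.sum_eq_zero fun j hj => ?_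
    have h0 := hre j hj
    have h1 := hm j
    simp only [Complex.normSq_apply] at h1
    simp at h0
    -- `|v m - v j|² = |v j|² - |v m|² + 2 Re (star (v m) * (v m - v j))`, where the last term is
    -- zero.
    have h2 : ((v m).re - (v j).re) ^ 2 + ((v m).im - (v j).im) ^ 2 ≤ 0 := by nlinarith
    have h3 : ((v m).re - (v j).re) = 0 := by
      nlinarith [sq_nonneg ((v m).re - (v j).re), sq_nonneg ((v m).im - (v j).im)]
    have h4 : ((v m).im - (v j).im) = 0 := by
      nlinarith [sq_nonneg ((v m).re - (v j).re), sq_nonneg ((v m).im - (v j).im)]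
    exact Complex.ext h3 h4
  rw [hsum, smul_zero, eq_comm, smul_eq_mul, mul_eq_zero, or_iff_right hμ] at heq
  rw [heq, map_zero] at hmpos
  exact lt_irrefl _ hmpos

theorem mem_complexEigenvalues {A : Matrix V V ℝ} {μ : ℂ} :
    μ ∈ complexEigenvalues A ↔ (complexEnd A).HasEigenvalue μ := by
  rw [Module.End.hasEigenvalue_iff_isRoot_charpoly, complexEnd, Matrix.charpoly_toLin',
    complexEigenvalues, Polynomial.mem_roots (Matrix.charpoly_monic _).ne_zero]

theorem re_pos_of_mem_complexEigenvalues {k : V → ℝ} (hk : ∀ i, 0 < k i) {μ : ℂ} (hμ : μ ≠ 0)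
    (h : μ ∈ complexEigenvalues (diagonal k * laplacian G)) : 0 < μ.re := by
  obtain ⟨v, hv⟩ := (mem_complexEigenvalues.1 h).exists_hasEigenvector
  exact re_pos_of_complexEnd_klap hk hμ hv.2 hv.apply_eq_smul

theorem count_complexEigenvalues (A : Matrix V V ℝ) (μ : ℂ) :
    (complexEigenvalues A).count μ = Module.finrank ℂ ((complexEnd A).maxGenEigenspace μ) := by
  rw [LinearMap.finrank_maxGenEigenspace_eq, complexEnd, Matrix.charpoly_toLin',
    complexEigenvalues, Polynomial.count_roots]

theorem count_complexEigenvalues_klap_zero {r : V}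
    (hr : ∀ i, Relation.ReflTransGen G.Adj i r) {k : V → ℝ} (hk : ∀ i, 0 < k i) :
    (complexEigenvalues (diagonal k * laplacian G)).count 0 = 1 := by
  rw [count_complexEigenvalues, maxGenEigenspace_klap_zero hr hk, finrank_span_singleton]
  intro h
  simpa using congrFun h r

theorem card_complexEigenvalues (A : Matrix V V ℝ) :
    (complexEigenvalues A).card = Fintype.card V := by
  rw [complexEigenvalues, IsAlgClosed.card_roots_eq_natDegree, Matrix.charpoly_natDegree_eq_dim]

theorem complexEigenvalues_klap_eq_cons {r : V}
    (hr : ∀ i, Relation.ReflTransGen G.Adj i r) {k : V → ℝ} (hk : ∀ i, 0 < k i) :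
    ∃ S : Multiset ℂ, complexEigenvalues (diagonal k * laplacian G) = 0 ::ₘ S ∧
      ∀ μ ∈ S, 0 < μ.re := by
  have h1 := count_complexEigenvalues_klap_zero hr hk
  have hmem : (0 : ℂ) ∈ complexEigenvalues (diagonal k * laplacian G) :=
    Multiset.count_pos.1 (by omega)
  refine ⟨_, (Multiset.cons_erase hmem).symm, fun μ hμ => ?_⟩
  refine re_pos_of_mem_complexEigenvalues hk ?_ (Multiset.mem_of_mem_erase hμ)
  rintro rfl
  have := Multiset.count_pos.2 hμ
  rw [Multiset.count_erase_self] at this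
  omega

theorem secondSmallestRe_klap {r : V} (hr : ∀ i, Relation.ReflTransGen G.Adj i r)
    {k : V → ℝ} (hk : ∀ i, 0 < k i) (hV : 2 ≤ Fintype.card V) :
    (∃ μ ∈ complexEigenvalues (diagonal k * laplacian G), μ ≠ 0) ∧
    0 < secondSmallestRe (diagonal k * laplacian G) ∧
      ∀ μ ∈ complexEigenvalues (diagonal k * laplacian G), μ ≠ 0 →
        secondSmallestRe (diagonal k * laplacian G) ≤ μ.re := by
  obtain ⟨S, hS, hpos⟩ := complexEigenvalues_klap_eq_cons hr hk
  have hcard := card_complexEigenvalues (diagonal k * laplacian G)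
  have hpos' : ∀ x ∈ S.map Complex.re, 0 < x := by
    intro x hx
    obtain ⟨μ, hμ, rfl⟩ := Multiset.mem_map.1 hx
    exact hpos μ hμ
  -- The simple eigenvalue `0` heads the sorted list because all others have positive real part; the
  -- second entry is the least of the rest.
  have hsec : secondSmallestRe (diagonal k * laplacian G) =
      ((S.map Complex.re).sort (· ≤ ·)).getD 0 0 := by
    rw [secondSmallestRe, hS, Multiset.map_cons, Complex.zero_re,
      Multiset.sort_cons _ _ _ fun b hb => (hpos' b hb).le, List.getD_cons_succ]
  rw [hS, Multiset.card_cons] at hcard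
  have hScard : 0 < S.card := by omega
  obtain ⟨μ₀, hμ₀⟩ := Multiset.card_pos_iff_exists_mem.1 hScard
  refine ⟨⟨μ₀, by rw [hS]; exact Multiset.mem_cons_of_mem hμ₀, fun h => ?_⟩, ?_⟩
  · simpa [h] using hpos μ₀ hμ₀
  rw [hsec]
  have hsorted := Multiset.pairwise_sort (S.map Complex.re) (· ≤ ·)
  have hmem : ∀ x, x ∈ (S.map Complex.re).sort (· ≤ ·) ↔ x ∈ S.map Complex.re := fun x =>
    Multiset.mem_sort _
  -- With at least two vertices a further eigenvalue exists, so the default value of `getD` is not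
  -- used.
  have hlen : ((S.map Complex.re).sort (· ≤ ·)) ≠ [] := by
    intro h
    have := (hmem μ₀.re).2 (Multiset.mem_map_of_mem _ hμ₀)
    simp [h] at this
  generalize (S.map Complex.re).sort (· ≤ ·) = l at hsorted hmem hlen
  cases l with
  | nil => exact absurd rfl hlen
  | cons a l =>
    rw [List.getD_cons_zero]
    refine ⟨hpos' a ((hmem a).1 List.mem_cons_self), fun μ hμ hμ0 => ?_⟩
    rw [hS, Multiset.mem_cons, or_iff_right hμ0] at hμ
    rcases List.mem_cons.1 ((hmem μ.re).2 (Multiset.mem_map_of_mem _ hμ)) with h | h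
    · exact h.ge
    · exact List.rel_of_pairwise_cons hsorted h

end Spectral


/-! ### Explicit solutions and uniqueness for linear systems -/

section Decay

variable {V : Type*} [Fintype V]

/-- The partial sums of the exponential series of `-t N`, applied to `x`. -/
noncomputable def expPartialSum (N : Module.End ℂ (V → ℂ)) (x : V → ℂ) (m : ℕ) (t : ℝ) : V → ℂ :=
  ∑ j ∈ Finset.range m, ((-t) ^ j / (j.factorial : ℝ)) • (N ^ j) x

theorem hasDerivAt_expPartialSum_succ (N : Module.End ℂ (V → ℂ)) (x : V → ℂ) (m : ℕ) (t : ℝ) :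
    HasDerivAt (expPartialSum N x (m + 1)) (-(N (expPartialSum N x m t))) t := by
  induction m with
  | zero =>
    have h : expPartialSum N x (0 + 1) = fun _ => x := by
      ext t i
      simp [expPartialSum]
    rw [h]
    simpa [expPartialSum] using hasDerivAt_const t x
  | succ m ih =>
    have h : expPartialSum N x (m + 1 + 1) = fun t => expPartialSum N x (m + 1) t +
        ((-t) ^ (m + 1) / ((m + 1).factorial : ℝ)) • (N ^ (m + 1)) x := by
      ext1 t
      rw [expPartialSum, Finset.sum_range_succ]
      rfl
    have hc : HasDerivAt (fun t : ℝ => (-t) ^ (m + 1) / ((m + 1).factorial : ℝ))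
        (-((-t) ^ m / (m.factorial : ℝ))) t := by
      refine ((((hasDerivAt_id t).neg).pow (m + 1)).div_const _).congr_deriv ?_
      have h0 : (m.factorial : ℝ) ≠ 0 := by positivity
      have h1 : ((m : ℝ) + 1) ≠ 0 := by positivity
      simp only [Nat.factorial_succ, Pi.neg_apply, id, Nat.add_sub_cancel]
      push_cast
      field_simp
    rw [h]
    refine (ih.add (hc.smul_const _)).congr_deriv ?_
    have hs : expPartialSum N x (m + 1) t =
        expPartialSum N x m t + ((-t) ^ m / (m.factorial : ℝ)) • (N ^ m) x := by
      rw [expPartialSum, Finset.sum_range_succ]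
      rfl
    rw [hs, map_add, LinearMap.map_smul_of_tower, pow_succ' N m, Module.End.mul_apply, neg_add,
      neg_smul]

/-- On a generalized eigenvector the exponential series of `-t (f - μ)` terminates, so `exp (-μ t)`
times its partial sum is an exact solution. `ψ` has to dominate only the finitely many modes that
occur. -/
theorem exists_solution_of_genEigenspace (f : Module.End ℂ (V → ℂ)) (μ : ℂ) (m : ℕ) {x : V → ℂ}
    (hx : ((f - μ • 1) ^ m) x = 0) {ψ : ℝ → ℝ} {A : ℝ}
    (hψ : ∀ j < m, ∀ t, 0 ≤ t → t ^ j * Real.exp (-μ.re * t) ≤ A * ψ t) :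
    ∃ (y : ℝ → V → ℂ) (C : ℝ), y 0 = x ∧ (∀ t, HasDerivAt y (-(f (y t))) t) ∧
      ∀ t, 0 ≤ t → ∀ i, ‖y t i‖ ≤ C * ψ t := by
  cases m with
  | zero =>
    have hx0 : x = 0 := by simpa using hx
    subst hx0
    refine ⟨fun _ => 0, 0, rfl, fun t => ?_, by simp⟩
    simpa using hasDerivAt_const t (0 : V → ℂ)
  | succ m =>
    set N := f - μ • (1 : Module.End ℂ (V → ℂ)) with hN
    refine ⟨fun t => Complex.exp (-μ * t) • expPartialSum N x (m + 1) t,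
      ∑ j ∈ Finset.range (m + 1), A * ‖(N ^ j) x‖, ?_, fun t => ?_, fun t ht i => ?_⟩
    · simp [expPartialSum, Finset.sum_range_succ']
    · have he : HasDerivAt (fun t : ℝ => Complex.exp (-μ * t)) (Complex.exp (-μ * t) * -μ) t := by
        have := (((hasDerivAt_id (t : ℂ)).const_mul (-μ)).cexp).comp_ofReal
        simpa using this
      refine (he.smul (hasDerivAt_expPartialSum_succ N x m t)).congr_deriv ?_
      -- Differentiation loses the top term, but `N` annihilates that term because `N ^ (m + 1)`
      -- kills `x`.
      have hs : N (expPartialSum N x m t) = N (expPartialSum N x (m + 1) t) := by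
        have : expPartialSum N x (m + 1) t =
            expPartialSum N x m t + ((-t) ^ m / (m.factorial : ℝ)) • (N ^ m) x := by
          rw [expPartialSum, Finset.sum_range_succ]
          rfl
        rw [this, map_add, LinearMap.map_smul_of_tower, ← Module.End.mul_apply, ← pow_succ', hx,
          smul_zero, add_zero]
      rw [hs, map_smul, hN]
      ext i
      simp
      ring
    · have hexp : ‖Complex.exp (-μ * t)‖ = Real.exp (-μ.re * t) := by
        rw [Complex.norm_exp]
        simp
      dsimp only
      rw [Pi.smul_apply, norm_smul, hexp, expPartialSum, Finset.sum_apply, Finset.sum_mul]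
      refine (mul_le_mul_of_nonneg_left (norm_sum_le _ _) (Real.exp_pos _).le).trans ?_
      rw [Finset.mul_sum]
      refine Finset.sum_le_sum fun j hj => ?_
      have h1 : ‖(-t) ^ j / (j.factorial : ℝ)‖ ≤ t ^ j := by
        rw [norm_div, norm_pow, norm_neg, Real.norm_of_nonneg ht, Real.norm_natCast]
        exact div_le_self (pow_nonneg ht _) (by exact_mod_cast Nat.factorial_pos j)
      rw [Pi.smul_apply, norm_smul]
      generalize (-t) ^ j / (j.factorial : ℝ) = a at h1 ⊢
      have h2 := norm_le_pi_norm ((N ^ j) x) i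
      have h3 := hψ j (Finset.mem_range.1 hj) t ht
      calc Real.exp (-μ.re * t) * (‖a‖ * ‖(N ^ j) x i‖)
          ≤ Real.exp (-μ.re * t) * (t ^ j * ‖(N ^ j) x‖) := by gcongr
        _ = (t ^ j * Real.exp (-μ.re * t)) * ‖(N ^ j) x‖ := by ring
        _ ≤ (A * ψ t) * ‖(N ^ j) x‖ := by gcongr
        _ = A * ‖(N ^ j) x‖ * ψ t := by ring

/-- The initial values of the solutions of `y' = -f y` that converge to a constant vector at the
rate `ψ`. -/
def consensusSubmodule (f : Module.End ℂ (V → ℂ)) (ψ : ℝ → ℝ) : Submodule ℂ (V → ℂ) where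
  carrier := {x | ∃ (y : ℝ → V → ℂ) (c : ℂ) (C : ℝ), y 0 = x ∧
    (∀ t, HasDerivAt y (-(f (y t))) t) ∧ ∀ t, 0 ≤ t → ∀ i, ‖y t i - c‖ ≤ C * ψ t}
  zero_mem' := ⟨fun _ => 0, 0, 0, rfl, fun t => by simpa using hasDerivAt_const t (0 : V → ℂ),
    by simp⟩
  add_mem' := by
    rintro x x' ⟨y, c, C, h0, h1, h2⟩ ⟨y', c', C', h0', h1', h2'⟩
    refine ⟨fun t => y t + y' t, c + c', C + C', by simp [h0, h0'], fun t => ?_, fun t ht i => ?_⟩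
    · refine ((h1 t).add (h1' t)).congr_deriv ?_
      rw [map_add, neg_add]
    · dsimp only
      rw [add_mul, Pi.add_apply, add_sub_add_comm]
      exact (norm_add_le _ _).trans (add_le_add (h2 t ht i) (h2' t ht i))
  smul_mem' := by
    rintro a x ⟨y, c, C, h0, h1, h2⟩
    refine ⟨fun t => a • y t, a * c, ‖a‖ * C, by simp [h0], fun t => ?_, fun t ht i => ?_⟩
    · refine ((h1 t).const_smul a).congr_deriv ?_
      rw [map_smul, smul_neg]
    · dsimp only
      rw [Pi.smul_apply, smul_eq_mul, ← mul_sub, norm_mul, mul_assoc]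
      exact mul_le_mul_of_nonneg_left (h2 t ht i) (norm_nonneg a)

/-- A linear right-hand side is Lipschitz. The values lie in a general `E` so that a real
fundamental matrix can act on quaternion vectors. -/
theorem linear_ode_eq {E : Type*} [NormedAddCommGroup E] [NormedSpace ℝ E] (A : Matrix V V ℝ)
    {u w : ℝ → V → E}
    (hu : ∀ t, 0 ≤ t → ∀ i, HasDerivWithinAt (fun t => u t i) (-∑ l, A i l • u t l) (Set.Ici 0) t)
    (hw : ∀ t, 0 ≤ t → ∀ i, HasDerivWithinAt (fun t => w t i) (-∑ l, A i l • w t l) (Set.Ici 0) t)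
    (h0 : u 0 = w 0) {t : ℝ} (ht : 0 ≤ t) : u t = w t := by
  let F : (V → E) →L[ℝ] (V → E) :=
    ContinuousLinearMap.pi fun i => -∑ l, A i l • ContinuousLinearMap.proj l
  have hF : ∀ x, F x = fun i => -∑ l, A i l • x l := fun x => by
    ext i
    simp [F]
  have key : ∀ v : ℝ → V → E, (∀ t, 0 ≤ t → ∀ i,
      HasDerivWithinAt (fun t => v t i) (-∑ l, A i l • v t l) (Set.Ici 0) t) →
      ∀ t, 0 ≤ t → HasDerivWithinAt v (F (v t)) (Set.Ici 0) t := fun v hv t ht => by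
    rw [hF]
    exact hasDerivWithinAt_pi.2 (hv t ht)
  refine ODE_solution_unique (v := fun _ => F) (fun _ => F.lipschitz)
    (fun s hs => ((key u hu s hs.1).continuousWithinAt).mono Set.Icc_subset_Ici_self)
    (fun s hs => (key u hu s hs.1).mono (Set.Ici_subset_Ici.2 hs.1))
    (fun s hs => ((key w hw s hs.1).continuousWithinAt).mono Set.Icc_subset_Ici_self)
    (fun s hs => (key w hw s hs.1).mono (Set.Ici_subset_Ici.2 hs.1)) h0 (Set.right_mem_Icc.2 ht)

end Decay

/-! ### Convergence to consensus and its rate -/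

section Consensus

variable {V : Type*} [Fintype V] [DecidableEq V] {G : Digraph V} [DecidableRel G.Adj]

/-- `ψ` dominates all modes of the nonzero eigenvalues of `A`. -/
def DominatesModes (A : Matrix V V ℝ) (ψ : ℝ → ℝ) : Prop :=
  ∀ μ ∈ complexEigenvalues A, μ ≠ 0 → ∃ B : ℝ, ∀ j < (complexEnd A).maxGenEigenspaceIndex μ,
    ∀ t, 0 ≤ t → t ^ j * Real.exp (-μ.re * t) ≤ B * ψ t

/-- It suffices to treat each generalized eigenspace: for `0` it consists of stationary constants,
for another eigenvalue the explicit solutions are bounded by a multiple of `ψ`, and otherwise it is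
trivial. -/
theorem consensusSubmodule_klap_eq_top {r : V} (hr : ∀ i, Relation.ReflTransGen G.Adj i r)
    {k : V → ℝ} (hk : ∀ i, 0 < k i) {ψ : ℝ → ℝ}
    (hψ : DominatesModes (diagonal k * laplacian G) ψ) :
    consensusSubmodule (complexEnd (diagonal k * laplacian G)) ψ = ⊤ := by
  rw [eq_top_iff, ← Module.End.iSup_maxGenEigenspace_eq_top (complexEnd (diagonal k * laplacian G)),
    iSup_le_iff]
  intro μ
  by_cases hμ : μ = 0
  · subst hμ
    rw [maxGenEigenspace_klap_zero hr hk, Submodule.span_singleton_le_iff_mem]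
    refine ⟨fun _ _ => 1, 1, 0, rfl, fun t => ?_, by simp⟩
    rw [complexEnd_klap_const, neg_zero]
    exact hasDerivAt_const t _
  by_cases hmem : μ ∈ complexEigenvalues (diagonal k * laplacian G)
  · obtain ⟨B, hB⟩ := hψ μ hmem hμ
    rw [Module.End.maxGenEigenspace_eq]
    intro x hx
    obtain ⟨y, C, h0, h1, h2⟩ := exists_solution_of_genEigenspace _ μ _
      (LinearMap.mem_ker.1 (Module.End.mem_genEigenspace_nat.1 hx)) hB
    exact ⟨y, 0, C, h0, h1, by simpa using h2⟩
  · have := count_complexEigenvalues (diagonal k * laplacian G) μ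
    rw [Multiset.count_eq_zero_of_notMem hmem, eq_comm, Submodule.finrank_eq_zero] at this
    rw [this]
    exact bot_le

/-- The columns are real parts of the complex solutions starting at basis vectors; they remain
solutions because the matrix is real. Consensus makes the limit `p j` independent of the row. -/
theorem exists_fundamental_matrix {r : V} (hr : ∀ i, Relation.ReflTransGen G.Adj i r)
    {k : V → ℝ} (hk : ∀ i, 0 < k i) {ψ : ℝ → ℝ}
    (hψ : DominatesModes (diagonal k * laplacian G) ψ) :
    ∃ (Y : ℝ → V → V → ℝ) (p : V → ℝ) (C : V → ℝ),
      (∀ i j, Y 0 i j = if i = j then 1 else 0) ∧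
      (∀ t i j, HasDerivAt (fun t => Y t i j)
        (-∑ l, (diagonal k * laplacian G) i l * Y t l j) t) ∧
      ∀ t, 0 ≤ t → ∀ i j, |Y t i j - p j| ≤ C j * ψ t := by
  have h : ∀ j : V, (Pi.single j 1 : V → ℂ) ∈
      consensusSubmodule (complexEnd (diagonal k * laplacian G)) ψ := fun j => by
    rw [consensusSubmodule_klap_eq_top hr hk hψ]
    trivial
  choose y c C h0 h1 h2 using h
  refine ⟨fun t i j => (y j t i).re, fun j => (c j).re, C, fun i j => ?_, fun t i j => ?_,
    fun t ht i j => ?_⟩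
  · simp only [h0, Pi.single_apply]
    split_ifs <;> simp
  · have hd := hasDerivAt_pi.1 (h1 j t) i
    have := Complex.reCLM.hasFDerivAt.comp_hasDerivAt t hd
    refine this.congr_deriv ?_
    rw [Pi.neg_apply, complexEnd_apply]
    simp
  · rw [← Complex.sub_re]
    exact (Complex.abs_re_le_norm _).trans (h2 j t ht i)

theorem exists_consensus_weights {r : V} (hr : ∀ i, Relation.ReflTransGen G.Adj i r)
    {k : V → ℝ} (hk : ∀ i, 0 < k i) {ψ : ℝ → ℝ} (hψ0 : ∀ t, 0 ≤ t → 0 ≤ ψ t)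
    (hψ : DominatesModes (diagonal k * laplacian G) ψ) :
    ∃ (p : V → ℝ) (C : ℝ), 0 ≤ C ∧ ∀ (E : Type) [NormedAddCommGroup E] [NormedSpace ℝ E]
      (w : ℝ → V → E),
      (∀ t, 0 ≤ t → ∀ i, HasDerivWithinAt (fun t => w t i)
        (-∑ l, (diagonal k * laplacian G) i l • w t l) (Set.Ici 0) t) →
      ∀ t, 0 ≤ t → ∀ i, ‖w t i - ∑ j, p j • w 0 j‖ ≤ C * ψ t * ∑ j, ‖w 0 j‖ := by
  obtain ⟨Y, p, C, h0, h1, h2⟩ := exists_fundamental_matrix hr hk hψ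
  refine ⟨p, ∑ j, |C j|, Finset.sum_nonneg fun j _ => abs_nonneg _, fun E _ _ w hw t ht i => ?_⟩
  have hwY : w t = fun i => ∑ j, Y t i j • w 0 j := by
    refine linear_ode_eq _ hw (w := fun t i => ∑ j, Y t i j • w 0 j) (fun t _ i => ?_) ?_ ht
    · refine HasDerivAt.hasDerivWithinAt ?_
      refine (HasDerivAt.fun_sum fun j _ => (h1 t i j).smul_const (w 0 j)).congr_deriv ?_
      simp only [neg_smul, Finset.sum_neg_distrib, Finset.sum_smul, Finset.smul_sum, smul_smul]
      rw [Finset.sum_comm]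
    · ext i
      simp [h0, ite_smul]
  rw [hwY]
  simp only [← Finset.sum_sub_distrib, ← sub_smul]
  refine (norm_sum_le _ _).trans ?_
  rw [Finset.mul_sum]
  refine Finset.sum_le_sum fun j _ => ?_
  rw [norm_smul]
  refine mul_le_mul_of_nonneg_right ((h2 t ht i j).trans ?_) (norm_nonneg _)
  exact mul_le_mul_of_nonneg_right ((le_abs_self _).trans
    (Finset.single_le_sum (f := fun j => |C j|) (fun j _ => abs_nonneg _) (Finset.mem_univ j)))
    (hψ0 t ht)

/-- The sum of all nonzero modes works for any number of vertices; with no nonzero eigenvalue it is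
the empty sum. -/
theorem exists_dominating_tendsto_zero {k : V → ℝ} (hk : ∀ i, 0 < k i) :
    ∃ ψ : ℝ → ℝ, (∀ t, 0 ≤ t → 0 ≤ ψ t) ∧ DominatesModes (diagonal k * laplacian G) ψ ∧
      Tendsto ψ atTop (𝓝 0) := by
  set A := diagonal k * laplacian G with hA
  set S := (complexEigenvalues A).toFinset.erase 0 with hS
  refine ⟨fun t => ∑ μ ∈ S, ∑ j ∈ Finset.range ((complexEnd A).maxGenEigenspaceIndex μ),
    t ^ j * Real.exp (-μ.re * t), fun t ht => ?_, fun μ hμ hμ0 => ⟨1, fun j hj t ht => ?_⟩, ?_⟩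
  · exact Finset.sum_nonneg fun μ _ => Finset.sum_nonneg fun j _ => by positivity
  · rw [one_mul]
    have hμS : μ ∈ S := Finset.mem_erase.2 ⟨hμ0, Multiset.mem_toFinset.2 hμ⟩
    refine (Finset.single_le_sum (f := fun j => t ^ j * Real.exp (-μ.re * t))
      (fun j _ => by positivity) (Finset.mem_range.2 hj)).trans ?_
    exact Finset.single_le_sum (f := fun μ : ℂ => ∑ j ∈ Finset.range
      ((complexEnd A).maxGenEigenspaceIndex μ), t ^ j * Real.exp (-μ.re * t))
      (fun μ _ => Finset.sum_nonneg fun j _ => by positivity) hμS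
  · rw [← Finset.sum_const_zero (s := S)]
    refine tendsto_finsetSum _ fun μ hμ => ?_
    rw [← Finset.sum_const_zero (s := Finset.range ((complexEnd A).maxGenEigenspaceIndex μ))]
    refine tendsto_finsetSum _ fun j _ => ?_
    have hpos : 0 < μ.re := re_pos_of_mem_complexEigenvalues hk (Finset.ne_of_mem_erase hμ)
      (Multiset.mem_toFinset.1 (Finset.mem_of_mem_erase hμ))
    refine ((isLittleO_pow_exp_pos_mul_atTop j hpos).tendsto_div_nhds_zero).congr fun t => ?_
    rw [neg_mul, Real.exp_neg, div_eq_mul_inv]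

theorem one_le_jordanFactor {m : ℕ} (hm : 1 ≤ m) {t : ℝ} (ht : 0 ≤ t) : 1 ≤ jordanFactor m t := by
  rcases hm.eq_or_lt with rfl | hm
  · simp [jordanFactor]
  · have h1 : (2 : ℝ) ≤ m := by exact_mod_cast hm
    have h2 : 0 ≤ (m : ℝ) / ((m - 1).factorial : ℝ) * t ^ (m - 1) := by positivity
    rw [jordanFactor]
    linarith

theorem pow_le_jordanFactor {m : ℕ} (hm : 1 ≤ m) {t : ℝ} (ht : 0 ≤ t) :
    t ^ (m - 1) ≤ ((m - 1).factorial : ℝ) * jordanFactor m t := by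
  have h1 : (1 : ℝ) ≤ m := by exact_mod_cast hm
  have h0 : (0 : ℝ) < ((m - 1).factorial : ℝ) := by positivity
  have h2 : ((m - 1).factorial : ℝ) * ((m : ℝ) / ((m - 1).factorial : ℝ) * t ^ (m - 1)) =
      m * t ^ (m - 1) := by field_simp
  rw [jordanFactor, mul_add, h2]
  nlinarith [pow_nonneg ht (m - 1), mul_nonneg h0.le (sub_nonneg.2 h1)]

theorem dominatesModes_jordanFactor {r : V} (hr : ∀ i, Relation.ReflTransGen G.Adj i r)
    {k : V → ℝ} (hk : ∀ i, 0 < k i) (hV : 2 ≤ Fintype.card V) :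
    1 ≤ largestNonzeroJordanBlock (diagonal k * laplacian G) ∧
    DominatesModes (diagonal k * laplacian G) fun t =>
      jordanFactor (largestNonzeroJordanBlock (diagonal k * laplacian G)) t *
        Real.exp (-secondSmallestRe (diagonal k * laplacian G) * t) := by
  obtain ⟨⟨μ₀, hμ₀, hμ₀'⟩, -, hle⟩ := secondSmallestRe_klap hr hk hV
  set A := diagonal k * laplacian G with hA
  have hidx : ∀ μ ∈ complexEigenvalues A, μ ≠ 0 →
      (complexEnd A).maxGenEigenspaceIndex μ ≤ largestNonzeroJordanBlock A := fun μ hμ hμ0 =>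
    Finset.le_sup (f := fun μ => (complexEnd A).maxGenEigenspaceIndex μ)
      (Finset.mem_erase.2 ⟨hμ0, Multiset.mem_toFinset.2 hμ⟩)
  have h1 : 1 ≤ largestNonzeroJordanBlock A := by
    -- Index zero would make the generalized eigenspace trivial, although its dimension is the
    -- positive multiplicity of `μ₀`.
    refine le_trans (Nat.one_le_iff_ne_zero.2 fun h => ?_) (hidx μ₀ hμ₀ hμ₀')
    have hb := Module.End.maxGenEigenspace_eq (complexEnd A) μ₀
    rw [h] at hb
    have hc := count_complexEigenvalues A μ₀
    rw [hb] at hc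
    rw [Nat.cast_zero, Module.End.genEigenspace_zero, finrank_bot] at hc
    exact (Multiset.count_pos.2 hμ₀).ne' hc
  refine ⟨h1, fun μ hμ hμ0 => ⟨1 + ((largestNonzeroJordanBlock A - 1).factorial : ℝ),
    fun j hj t ht => ?_⟩⟩
  generalize largestNonzeroJordanBlock A = m at *
  have hj' : j ≤ m - 1 := by
    have := hidx μ hμ hμ0
    omega
  have hpow : t ^ j ≤ (1 + ((m - 1).factorial : ℝ)) * jordanFactor m t := by
    rw [add_mul, one_mul]
    -- For `t ≤ 1` the power is at most `1`, which `jordanFactor` dominates; for `t ≥ 1` it is at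
    -- most `t ^ (m - 1)`, at the cost of the factor `(m - 1)!`.
    rcases le_total t 1 with h | h
    · have := one_le_jordanFactor h1 ht
      have h' := (pow_nonneg ht (m - 1)).trans (pow_le_jordanFactor h1 ht)
      linarith [pow_le_one₀ ht h (n := j)]
    · have := one_le_jordanFactor h1 ht
      linarith [pow_le_jordanFactor h1 ht, pow_le_pow_right₀ h hj']
  have hexp : Real.exp (-μ.re * t) ≤ Real.exp (-secondSmallestRe A * t) := by
    apply Real.exp_le_exp.2
    nlinarith [hle μ hμ hμ0]
  rw [← mul_assoc]
  exact mul_le_mul hpow hexp (Real.exp_pos _).le ((pow_nonneg ht j).trans hpow)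

end Consensus


/-! ### Unit dual quaternions are invertible -/

section UnitDualQuaternions

theorem star_mul_self_of_mem_unitDualQuaternions {q : DualQuaternion}
    (hq : q ∈ unitDualQuaternions) : star q * q = 1 := by
  obtain ⟨h1, h2⟩ := hq
  ext1
  · rw [TrivSqZeroExt.fst_mul, fst_star, Quaternion.star_mul_self, Quaternion.normSq_eq_norm_mul_self,
      h1]
    simp
  · rw [TrivSqZeroExt.snd_mul, fst_star, snd_star, smul_eq_mul, op_smul_eq_mul, h2]
    simp

theorem self_mul_star_of_mem_unitDualQuaternions {q : DualQuaternion}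
    (hq : q ∈ unitDualQuaternions) : q * star q = 1 := by
  have h : star q.fst * q.fst = 1 := by
    simpa using congrArg TrivSqZeroExt.fst (star_mul_self_of_mem_unitDualQuaternions hq)
  have h' : q.fst * star q.fst = 1 := mul_eq_one_comm.1 h
  have hd : star q.fst * q.snd + star q.snd * q.fst = 0 := hq.2
  have hd' : q.fst * star q.snd + q.snd * star q.fst = 0 := by
    -- This is the unit condition conjugated by the standard part.
    calc q.fst * star q.snd + q.snd * star q.fst
        = q.fst * (star q.fst * q.snd + star q.snd * q.fst) * star q.fst := by
          rw [mul_add, add_mul, ← mul_assoc, h', one_mul, mul_assoc q.fst, mul_assoc (star q.snd),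
            h', mul_one, add_comm]
      _ = 0 := by rw [hd, mul_zero, zero_mul]
  ext1
  · simpa using h'
  · rw [TrivSqZeroExt.snd_mul, fst_star, snd_star, smul_eq_mul, op_smul_eq_mul, hd']
    simp

end UnitDualQuaternions

/-! ### Bounds for the dual-number norm -/

section DualVecNorm

theorem abs_re_le_norm (a : ℍ[ℝ]) : |a.re| ≤ ‖a‖ := by
  refine abs_le_of_sq_le_sq ?_ (norm_nonneg a)
  rw [sq ‖a‖, ← Quaternion.normSq_eq_norm_mul_self, Quaternion.normSq_def']
  nlinarith [sq_nonneg a.imI, sq_nonneg a.imJ, sq_nonneg a.imK]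

variable {V : Type*} [Fintype V]

theorem quatVecNorm_nonneg (x : V → ℍ[ℝ]) : 0 ≤ quatVecNorm x := Real.sqrt_nonneg _

theorem norm_le_quatVecNorm (x : V → ℍ[ℝ]) (i : V) : ‖x i‖ ≤ quatVecNorm x :=
  Real.le_sqrt_of_sq_le
    (Finset.single_le_sum (f := fun i => ‖x i‖ ^ 2) (fun _ _ => sq_nonneg _) (Finset.mem_univ i))

theorem quatVecNorm_le_sum (x : V → ℍ[ℝ]) : quatVecNorm x ≤ ∑ i, ‖x i‖ := by
  have h0 : 0 ≤ ∑ i, ‖x i‖ := Finset.sum_nonneg fun i _ => norm_nonneg _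
  refine Real.sqrt_le_iff.2 ⟨h0, ?_⟩
  rw [sq, Finset.sum_mul]
  refine Finset.sum_le_sum fun i hi => ?_
  rw [sq]
  exact mul_le_mul_of_nonneg_left
    (Finset.single_le_sum (f := fun i => ‖x i‖) (fun i _ => norm_nonneg _) hi) (norm_nonneg _)

theorem fst_dualVecNorm (x : V → DualQuaternion) :
    (dualVecNorm x).fst = quatVecNorm fun i => (x i).fst := by
  rw [dualVecNorm]
  split_ifs with h
  · simp [quatVecNorm, h]
  · simp

/-- The numerator carries a factor `‖x_s‖` that cancels the denominator, so the bound does not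
deteriorate as the standard part tends to zero. -/
theorem abs_snd_dualVecNorm_le (x : V → DualQuaternion) :
    |(dualVecNorm x).snd| ≤ 2 * ∑ i, ‖(x i).snd‖ := by
  have h0 : 0 ≤ ∑ i, ‖(x i).snd‖ := Finset.sum_nonneg fun i _ => norm_nonneg _
  rw [dualVecNorm]
  split_ifs with h
  · rw [TrivSqZeroExt.snd_inr, abs_of_nonneg (quatVecNorm_nonneg _)]
    have := quatVecNorm_le_sum fun i => (x i).snd
    linarith
  · rw [TrivSqZeroExt.snd_add, TrivSqZeroExt.snd_inl, TrivSqZeroExt.snd_inr, zero_add, abs_div,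
      abs_of_nonneg (quatVecNorm_nonneg _)]
    refine div_le_of_le_mul₀ (quatVecNorm_nonneg _) (by positivity) ?_
    refine (abs_re_le_norm _).trans ((norm_sum_le _ _).trans ?_)
    rw [Finset.mul_sum, Finset.sum_mul]
    refine Finset.sum_le_sum fun i _ => ?_
    have h1 := norm_le_quatVecNorm (fun i => (x i).fst) i
    refine (norm_add_le _ _).trans ?_
    rw [norm_mul, norm_mul, norm_star, norm_star]
    nlinarith [mul_le_mul_of_nonneg_left h1 (norm_nonneg (x i).snd)]

end DualVecNorm

/-! ### Reduction of the control law to the real system -/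

section Motion

variable {V : Type*} [Fintype V]

attribute [local instance] TrivSqZeroExt.instL1NormedAddCommGroup TrivSqZeroExt.instL1NormedSpace in
/-- The derivative of a curve of dual quaternion vectors under a continuous linear map. -/
theorem hasDerivWithinAt_clm_comp {z : ℝ → V → DualQuaternion} {z' : V → DualQuaternion}
    {s : Set ℝ} {t : ℝ} (h : HasDerivWithinAt z z' s t) (ℓ : (V → DualQuaternion) →L[ℝ] ℍ[ℝ]) :
    HasDerivWithinAt (fun t => ℓ (z t)) (ℓ z') s t :=
  ℓ.hasFDerivAt.comp_hasDerivWithinAt t h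

/-- Left multiplication of the `i`-th entry by `a`, as a continuous linear map. -/
noncomputable def mulProj (a : DualQuaternion) (i : V) : (V → DualQuaternion) →L[ℝ] DualQuaternion where
  toFun x := a * x i
  map_add' x y := by rw [Pi.add_apply, mul_add]
  map_smul' c x := by rw [Pi.smul_apply, mul_smul_comm, RingHom.id_apply]
  cont := continuous_const.mul (continuous_apply i)

variable [DecidableEq V] {G : Digraph V} [DecidableRel G.Adj]

/-- Reasonable weights enter here: on an arc `q i * (star (q i) * q l) = q l`, so multiplication by
`q i` turns the dual Laplacian into the real one acting on `q l * x l`. -/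
theorem mul_precondition_mul_dualLaplacian {k : V → ℝ} {φ : UDQWeights G} {q : V → DualQuaternion}
    (hq : φ.IsDesiredFormation q) (x : V → DualQuaternion) (i : V) :
    q i * ((precondition k q * φ.dualLaplacian) *ᵥ x) i =
      ∑ l, (diagonal k * laplacian G) i l • (q l * x l) := by
  have h2 : ∀ i, q i * star (q i) = 1 := fun i => self_mul_star_of_mem_unitDualQuaternions (hq.1 i)
  have hL : ∀ i l, q i * φ.dualLaplacian i l = laplacian G i l • q l := by
    intro i l
    simp only [UDQWeights.dualLaplacian, laplacian, Matrix.sub_apply, Matrix.of_apply,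
      Matrix.diagonal_apply, mul_sub, sub_smul]
    congr 1
    · split_ifs with h
      · rw [h, (Nat.cast_commute _ _).eq.symm, Nat.cast_smul_eq_nsmul, nsmul_eq_mul]
      · simp
    · split_ifs with h
      · rw [hq.2 i l h, ← mul_assoc, h2, one_mul, one_smul]
      · simp
  have hP : precondition k q = diagonal fun i => star (q i) * (algebraMap ℝ DualQuaternion (k i) * q i) := by
    rw [precondition, Matrix.diagonal_conjTranspose, Matrix.diagonal_map (map_zero _),
      Matrix.diagonal_mul_diagonal, Matrix.diagonal_mul_diagonal]
    congr 1
    ext1 i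
    rw [mul_assoc]
    rfl
  rw [hP, ← Matrix.mulVec_mulVec, Matrix.mulVec_diagonal, ← mul_assoc, ← mul_assoc, h2, one_mul,
    Matrix.mulVec, dotProduct, mul_assoc, Finset.mul_sum, ← Algebra.smul_def, Finset.smul_sum]
  refine Finset.sum_congr rfl fun l _ => ?_
  rw [Matrix.diagonal_mul, ← mul_assoc, hL, mul_smul]
  exact congrArg (k i • ·) (Algebra.smul_mul_assoc (laplacian G i l) (q l) (x l))

theorem IsControlledMotion.hasDerivWithinAt_clm {k : V → ℝ} {φ : UDQWeights G}
    {q : V → DualQuaternion} (hq : φ.IsDesiredFormation q) {z : ℝ → V → DualQuaternion}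
    (hz : IsControlledMotion (precondition k q) φ.dualLaplacian z) (ℓ : DualQuaternion →L[ℝ] ℍ[ℝ])
    {t : ℝ} (ht : 0 ≤ t) (i : V) :
    HasDerivWithinAt (fun t => ℓ (q i * z t i))
      (-∑ l, (diagonal k * laplacian G) i l • ℓ (q l * z t l)) (Set.Ici 0) t := by
  have h := hasDerivWithinAt_clm_comp (hz t ht) (ℓ.comp (mulProj (q i) i))
  refine h.congr_deriv ?_
  change ℓ (q i * -_) = _
  rw [mul_neg, mul_precondition_mul_dualLaplacian hq, map_neg, map_sum]
  simp only [map_smul]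

/-- Standard and dual parts of `q i * z i` obey the same real system, hence share the limit weights
and the constant, which is fixed before `φ`, `q` and `z`. -/
theorem exists_consensus_estimate {r : V} (hr : ∀ i, Relation.ReflTransGen G.Adj i r)
    {k : V → ℝ} (hk : ∀ i, 0 < k i) {ψ : ℝ → ℝ} (hψ0 : ∀ t, 0 ≤ t → 0 ≤ ψ t)
    (hψ : DominatesModes (diagonal k * laplacian G) ψ) (hlim : Tendsto ψ atTop (𝓝 0)) :
    ∃ C : ℝ, 0 ≤ C ∧ ∀ (φ : UDQWeights G) (q : V → DualQuaternion), φ.IsDesiredFormation q →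
      ∀ z : ℝ → V → DualQuaternion,
        IsControlledMotion (precondition k q) φ.dualLaplacian z →
        ∃ c : DualQuaternion, Tendsto z atTop (𝓝 fun i => star (q i) * c) ∧
          ∀ t, 0 ≤ t → ∀ i,
            ‖(q i * z t i - c).fst‖ ≤ C * ψ t * ∑ j, ‖(q j * z 0 j).fst‖ ∧
            ‖(q i * z t i - c).snd‖ ≤ C * ψ t * ∑ j, ‖(q j * z 0 j).snd‖ := by
  obtain ⟨p, C, hC, h⟩ := exists_consensus_weights hr hk hψ0 hψ
  refine ⟨C, hC, fun φ q hq z hz => ?_⟩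
  let ℓs : DualQuaternion →L[ℝ] ℍ[ℝ] :=
    { toFun := TrivSqZeroExt.fst
      map_add' := TrivSqZeroExt.fst_add
      map_smul' := fun _ _ => rfl
      cont := TrivSqZeroExt.continuous_fst }
  let ℓd : DualQuaternion →L[ℝ] ℍ[ℝ] :=
    { toFun := TrivSqZeroExt.snd
      map_add' := TrivSqZeroExt.snd_add
      map_smul' := fun _ _ => rfl
      cont := TrivSqZeroExt.continuous_snd }
  have hs := h ℍ[ℝ] (fun t i => (q i * z t i).fst)
    fun t ht i => hz.hasDerivWithinAt_clm hq ℓs ht i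
  have hd := h ℍ[ℝ] (fun t i => (q i * z t i).snd)
    fun t ht i => hz.hasDerivWithinAt_clm hq ℓd ht i
  set cs := ∑ j, p j • (q j * z 0 j).fst with hcs
  set cd := ∑ j, p j • (q j * z 0 j).snd with hcd
  refine ⟨TrivSqZeroExt.inl cs + TrivSqZeroExt.inr cd, ?_, fun t ht i => ⟨?_, ?_⟩⟩
  · have aux : ∀ (w : ℝ → V → ℍ[ℝ]) (c : ℍ[ℝ]) (B : ℝ),
        (∀ t, 0 ≤ t → ∀ i, ‖w t i - c‖ ≤ C * ψ t * B) → ∀ i,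
        Tendsto (fun t => w t i) atTop (𝓝 c) := fun w c B hw i => by
      rw [tendsto_iff_norm_sub_tendsto_zero]
      refine squeeze_zero' (Eventually.of_forall fun t => norm_nonneg _)
        ((eventually_ge_atTop 0).mono fun t ht => hw t ht i) ?_
      simpa using (hlim.const_mul C).mul_const B
    refine tendsto_pi_nhds.2 fun i => ?_
    have hw : Tendsto (fun t => q i * z t i) atTop
        (𝓝 (TrivSqZeroExt.inl cs + TrivSqZeroExt.inr cd)) := by
      rw [TrivSqZeroExt.nhds_def]
      refine Tendsto.prodMk (f := atTop) ?_ ?_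
      · have hfst : (TrivSqZeroExt.inl cs + TrivSqZeroExt.inr cd : DualQuaternion).fst = cs := by simp
        rw [hfst]
        exact aux _ _ _ hs i
      · have hsnd : (TrivSqZeroExt.inl cs + TrivSqZeroExt.inr cd : DualQuaternion).snd = cd := by simp
        rw [hsnd]
        exact aux _ _ _ hd i
    refine (hw.const_mul (star (q i))).congr fun t => ?_
    rw [← mul_assoc, star_mul_self_of_mem_unitDualQuaternions (hq.1 i), one_mul]
  · simpa using hs t ht i
  · simpa using hd t ht i

theorem exists_rate_estimate {r : V} (hr : ∀ i, Relation.ReflTransGen G.Adj i r)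
    {k : V → ℝ} (hk : ∀ i, 0 < k i) {ψ : ℝ → ℝ} (hψ0 : ∀ t, 0 ≤ t → 0 < ψ t)
    (hψ : DominatesModes (diagonal k * laplacian G) ψ) (hlim : Tendsto ψ atTop (𝓝 0)) :
    ∃ C : ℝ, 0 < C ∧
      ∀ (φ : UDQWeights G) (q : V → DualQuaternion), φ.IsDesiredFormation q →
      ∀ z : ℝ → V → DualQuaternion,
        IsControlledMotion (precondition k q) φ.dualLaplacian z →
        (∀ i, z 0 i ∈ unitDualQuaternions) →
        ∀ c : DualQuaternion, Tendsto z atTop (𝓝 fun i => star (q i) * c) →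
          (∀ t : ℝ, 0 ≤ t →
            (dualVecNorm fun i => z t i - star (q i) * c).fst < C * ψ t) ∧
          ∃ C' : ℝ, ∀ t : ℝ, 0 ≤ t →
            |(dualVecNorm fun i => z t i - star (q i) * c).fst| ≤ C' * ψ t ∧
            |(dualVecNorm fun i => z t i - star (q i) * c).snd| ≤ C' * ψ t := by
  obtain ⟨C, hC, h⟩ := exists_consensus_estimate hr hk (fun t ht => (hψ0 t ht).le) hψ hlim
  set n : ℝ := (Fintype.card V : ℝ) with hn
  -- One `n` comes from the initial standard parts, each of norm one, the other from summing over
  -- the entries; the `+ 1` makes the inequality strict.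
  refine ⟨n * (C * n) + 1, by positivity, fun φ q hq z hz hunit c hc => ?_⟩
  obtain ⟨c', hc', hest⟩ := h φ q hq z hz
  have hcc : c = c' := by
    have := congrFun (tendsto_nhds_unique hc hc') r
    have h2 := congrArg (q r * ·) this
    simpa only [← mul_assoc, self_mul_star_of_mem_unitDualQuaternions (hq.1 r), one_mul] using h2
  subst hcc
  have hfac : ∀ t i, z t i - star (q i) * c = star (q i) * (q i * z t i - c) := fun t i => by
    rw [mul_sub, ← mul_assoc, star_mul_self_of_mem_unitDualQuaternions (hq.1 i), one_mul]
  have hinit : ∑ j, ‖(q j * z 0 j).fst‖ = n := by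
    rw [Finset.sum_congr rfl fun j _ => by
      rw [TrivSqZeroExt.fst_mul, norm_mul, (hq.1 j).1, (hunit j).1, mul_one]]
    simp [hn]
  rw [hinit] at hest
  have hfst : ∀ t, 0 ≤ t → ∀ i, ‖(z t i - star (q i) * c).fst‖ ≤ C * ψ t * n := fun t ht i => by
    rw [hfac, TrivSqZeroExt.fst_mul, norm_mul, fst_star, norm_star, (hq.1 i).1, one_mul]
    exact (hest t ht i).1
  have hfst' : ∀ t, 0 ≤ t → (dualVecNorm fun i => z t i - star (q i) * c).fst ≤
      n * (C * n) * ψ t := fun t ht => by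
    rw [fst_dualVecNorm]
    refine (quatVecNorm_le_sum _).trans ((Finset.sum_le_sum fun i _ => hfst t ht i).trans_eq ?_)
    rw [Finset.sum_const, Finset.card_univ, nsmul_eq_mul]
    ring
  refine ⟨fun t ht => ?_, ?_⟩
  · have := hfst' t ht
    have := hψ0 t ht
    linarith
  set B := ∑ j, ‖(q j * z 0 j).snd‖ with hB
  have hB0 : 0 ≤ B := Finset.sum_nonneg fun j _ => norm_nonneg _
  -- Undoing the substitution mixes the parts: the dual part of `star (q i)` multiplies the standard
  -- error, which decays at the same rate.
  have hsnd : ∀ t, 0 ≤ t → ∀ i, ‖(z t i - star (q i) * c).snd‖ ≤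
      C * ψ t * B + C * ψ t * n * ‖(q i).snd‖ := fun t ht i => by
    rw [hfac, TrivSqZeroExt.snd_mul, fst_star, snd_star, smul_eq_mul, op_smul_eq_mul]
    refine (norm_add_le _ _).trans ?_
    rw [norm_mul, norm_mul, norm_star, norm_star, (hq.1 i).1, one_mul, mul_comm ‖(q i).snd‖]
    exact add_le_add (hest t ht i).2
      (mul_le_mul_of_nonneg_right (hest t ht i).1 (norm_nonneg _))
  refine ⟨n * (C * n) + 2 * ∑ i, (C * B + C * n * ‖(q i).snd‖), fun t ht => ⟨?_, ?_⟩⟩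
  · rw [abs_of_nonneg (by rw [fst_dualVecNorm]; exact quatVecNorm_nonneg _), add_mul]
    have h0 : 0 ≤ 2 * ∑ i, (C * B + C * n * ‖(q i).snd‖) :=
      mul_nonneg two_pos.le (Finset.sum_nonneg fun i _ => by positivity)
    exact (hfst' t ht).trans (le_add_of_nonneg_right (mul_nonneg h0 (hψ0 t ht).le))
  · refine (abs_snd_dualVecNorm_le _).trans ?_
    rw [add_mul]
    have h0 : 0 ≤ n * (C * n) * ψ t := mul_nonneg (by positivity) (hψ0 t ht).le
    refine le_trans ?_ (le_add_of_nonneg_left h0)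
    rw [mul_assoc, Finset.sum_mul]
    refine mul_le_mul_of_nonneg_left (Finset.sum_le_sum fun i _ => ?_) two_pos.le
    exact (hsnd t ht i).trans_eq (by ring)

theorem tendsto_jordanFactor_mul_exp (m : ℕ) {b : ℝ} (hb : 0 < b) :
    Tendsto (fun t => jordanFactor m t * Real.exp (-b * t)) atTop (𝓝 0) := by
  have key : ∀ j : ℕ, Tendsto (fun t : ℝ => t ^ j * Real.exp (-b * t)) atTop (𝓝 0) := fun j =>
    ((isLittleO_pow_exp_pos_mul_atTop j hb).tendsto_div_nhds_zero).congr fun t => by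
      rw [neg_mul, Real.exp_neg, div_eq_mul_inv]
  have := ((key 0).const_mul ((m : ℝ) - 1)).add
    ((key (m - 1)).const_mul ((m : ℝ) / ((m - 1).factorial : ℝ)))
  rw [mul_zero, mul_zero, add_zero] at this
  refine this.congr fun t => ?_
  rw [jordanFactor]
  ring

end Motion

end DQFormation

theorem theorem1 {V : Type*} [Fintype V] [DecidableEq V]
    (G : Digraph V) [DecidableRel G.Adj] (hG : HasDirectedSpanningTree G)
    (k : V → ℝ) (hk : ∀ i, 0 < k i) :
    -- (i) global asymptotic convergence
    (∀ (φ : UDQWeights G) (q : V → DualQuaternion), φ.IsDesiredFormation q →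
      ∀ z : ℝ → V → DualQuaternion,
        IsControlledMotion (precondition k q) φ.dualLaplacian z →
        ∃ c : DualQuaternion, Tendsto z atTop (𝓝 fun i => star (q i) * c)) ∧
    -- (ii) convergence rate for unit initial configurations
    (2 ≤ Fintype.card V →
      0 < secondSmallestRe (Matrix.diagonal k * laplacian G) ∧
      ∃ C : ℝ, 0 < C ∧
        ∀ (φ : UDQWeights G) (q : V → DualQuaternion), φ.IsDesiredFormation q →
        ∀ z : ℝ → V → DualQuaternion,
          IsControlledMotion (precondition k q) φ.dualLaplacian z →
          (∀ i, z 0 i ∈ unitDualQuaternions) →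
          ∀ c : DualQuaternion, Tendsto z atTop (𝓝 fun i => star (q i) * c) →
            -- the bound in the order of dual numbers, with a constant that depends on `G, K` only
            (∀ t : ℝ, 0 ≤ t →
              DualLE (dualVecNorm fun i => z t i - star (q i) * c)
                (TrivSqZeroExt.inl (C *
                  jordanFactor (largestNonzeroJordanBlock (Matrix.diagonal k * laplacian G)) t *
                  Real.exp (-secondSmallestRe (Matrix.diagonal k * laplacian G) * t)))) ∧
            -- both parts of the dual number tend to zero at the same rate
            (∃ C' : ℝ, ∀ t : ℝ, 0 ≤ t →
              |(dualVecNorm fun i => z t i - star (q i) * c).fst| ≤ C' *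
                jordanFactor (largestNonzeroJordanBlock (Matrix.diagonal k * laplacian G)) t *
                Real.exp (-secondSmallestRe (Matrix.diagonal k * laplacian G) * t) ∧
              |(dualVecNorm fun i => z t i - star (q i) * c).snd| ≤ C' *
                jordanFactor (largestNonzeroJordanBlock (Matrix.diagonal k * laplacian G)) t *
                Real.exp (-secondSmallestRe (Matrix.diagonal k * laplacian G) * t))) := by
  obtain ⟨r, hr⟩ := hG.exists_root
  constructor
  · obtain ⟨ψ, hψ0, hψ, hlim⟩ := exists_dominating_tendsto_zero (G := G) hk
    obtain ⟨_, -, h⟩ := exists_consensus_estimate hr hk hψ0 hψ hlim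
    intro φ q hq z hz
    obtain ⟨c, hc, -⟩ := h φ q hq z hz
    exact ⟨c, hc⟩
  · intro hV
    obtain ⟨-, hpos, -⟩ := secondSmallestRe_klap hr hk hV
    obtain ⟨h1, hψ⟩ := dominatesModes_jordanFactor hr hk hV
    obtain ⟨C, hC, h⟩ := exists_rate_estimate hr hk
      (fun t ht => mul_pos (zero_lt_one.trans_le (one_le_jordanFactor h1 ht)) (Real.exp_pos _))
      hψ (tendsto_jordanFactor_mul_exp _ hpos)
    refine ⟨hpos, C, hC, fun φ q hq z hz hunit c hc => ?_⟩
    obtain ⟨hle, C', hC'⟩ := h φ q hq z hz hunit c hc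
    -- Strict inequality of the standard parts decides the dual order, whatever the dual part.
    refine ⟨fun t ht => Or.inl ?_, C', fun t ht => ?_⟩
    · rw [TrivSqZeroExt.fst_inl, mul_assoc]
      exact hle t ht
    · simpa only [mul_assoc] using hC' t ht
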